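/- For $m\ge 1$ and $x=(x_1,\dots,x_m)\in\mathbb C^m$ put $c_k(x)=\sum_{1\le i\le m,\;1\le i-k\le m}x_i\overline{x_{i-k}}$ for $k\in\mathbb Z$ (so $c_{-k}(x)=\overline{c_k(x)}$ and $c_k(x)=0$ for $|k|\ge m$). Let $\mathbf C_x$ be the $m\times m$ Hermitian Toeplitz matrix with $(i,j)$ entry $c_{j-i}(x)$, and let $y_k=\sum_{i=1}^m x_i e^{-2\pi\mathrm{j}ki/m}$, where $\mathrm j^2=-1$ and $0\le k\le m-1$, so that $(|y_0|^2,\dots,|y_{m-1}|^2)$ is the power spectrum of $x$. Then the following hold. (1) For every $m\ge1$, every $x\in\mathbb C^m$ and every $0\le k\le m-1$, $$|y_k|^2=\sum_{i=1-m}^{m-1}c_i(x)\,e^{-2\pi\mathrm{j}ki/m}.$$ (2) For every $m$ let $x^{(m)}\in\mathbb C^m$, with power spectrum $|y^{(m)}_k|^2$, and suppose that $\sum_k c_k(x^{(m)})$ converges absolutely, uniformly in $m$: $\sup_m\sum_{|k|<m}|c_k(x^{(m)})|<\infty$, and for every $\varepsilon>0$ there is $K$ with $\sum_{K\le|k|<m}|c_k(x^{(m)})|\le\varepsilon$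 for all $m$. Then the eigenvalues of $\mathbf C_{x^{(m)}}$ (with multiplicity) can be listed as $\lambda^{(m)}_0,\dots,\lambda^{(m)}_{m-1}$ so that $$\max_{0\le k\le m-1}\bigl|\lambda^{(m)}_k-|y^{(m)}_k|^2\bigr|\longrightarrow0\qquad(m\to\infty).$$ (3) Let $(x_i)_{i\ge1}$ be one infinite complex sequence and $x^{(m)}=(x_1,\dots,x_m)$. Suppose that for every $k\in\mathbb Z$ the limit $c_k=\lim_{m\to\infty}c_k(x^{(m)})$ exists in $\mathbb C$, and that $\sum_{k\in\mathbb Z}|c_k|<\infty$. Then the eigenvalues of $\mathbf C_{x^{(m)}}$ (with multiplicity) can be listed as $\lambda^{(m)}_0,\dots,\lambda^{(m)}_{m-1}$ so that $$\frac1m\sum_{k=0}^{m-1}\bigl|\lambda^{(m)}_k-|y^{(m)}_k|^2\bigr|\longrightarrow0\qquad(m\to\infty).$$ -/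

import Mathlib

open Filter Topology

noncomputable section

/-- Autocorrelation of a finite signal: `c_k` is the sum of `x_i * conj (x_{i-k})` over all `i` for
which both indices lie in the index range. Hence `c_{-k} = conj c_k`, and `c_k = 0` for `|k| ≥ m`.
(Only differences of indices enter, so indexing from `0` or from `1` gives the same value.) -/
def autocorr {m : ℕ} (x : Fin m → ℂ) (k : ℤ) : ℂ :=
  ∑ p : Fin m × Fin m with (p.1 : ℤ) - (p.2 : ℤ) = k, x p.1 * (starRingEnd ℂ) (x p.2)

/-- The Toeplitz covariance matrix `C_x`, with first row `c_0, c_1, …, c_{m-1}` and first column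
`c_0, c_{-1}, …, c_{1-m}`. -/
def covMatrix {m : ℕ} (x : Fin m → ℂ) : Matrix (Fin m) (Fin m) ℂ :=
  Matrix.of fun i j => autocorr x ((j : ℤ) - (i : ℤ))

/-- The discrete Fourier transform `y_k = ∑_{i=1}^m x_i e^{-2πj k i / m}`; the entry `x_i` of the
signal is `x (i-1)` here. -/
def signalDFT {m : ℕ} (x : Fin m → ℂ) (k : Fin m) : ℂ :=
  ∑ i : Fin m, x i *
    Complex.exp (-(Complex.I * (2 * Real.pi * (k : ℕ) * ((i : ℕ) + 1) / m)))

/-- The power spectrum `|y_k|²`. -/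
def powerSpectrum {m : ℕ} (x : Fin m → ℂ) (k : Fin m) : ℝ :=
  ‖signalDFT x k‖ ^ 2

/-- `ev 0, …, ev (m-1)` are the eigenvalues of `A`, listed with multiplicity in some order. -/
def IsEigenvalueList {m : ℕ} (A : Matrix (Fin m) (Fin m) ℂ) (ev : Fin m → ℝ) : Prop :=
  A.charpoly = ∏ k : Fin m, (Polynomial.X - Polynomial.C (ev k : ℂ))

/-- For signals `x m` of length `m`, the series `∑_k c_k(x m)` of autocorrelations converges
absolutely, uniformly in the length `m`: the absolute sums are bounded, and their tails are
uniformly small. -/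
def UniformlyAbsSummableAutocorr (x : (m : ℕ) → Fin m → ℂ) : Prop :=
  (∃ M : ℝ, ∀ m : ℕ, ∑ k ∈ Finset.Ioo (-(m : ℤ)) (m : ℤ), ‖autocorr (x m) k‖ ≤ M) ∧
  ∀ ε : ℝ, 0 < ε → ∃ K : ℕ, ∀ m : ℕ,
    ∑ k ∈ Finset.Ioo (-(m : ℤ)) (m : ℤ) with (K : ℤ) ≤ |k|, ‖autocorr (x m) k‖ ≤ ε

/-- The first `m` samples of an infinite signal. -/
def initialSegment (s : ℕ → ℂ) (m : ℕ) : Fin m → ℂ := fun i => s i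

end

/-!
The function `f_m(t) = ∑_k c_k(x) e^{-2πi k t}` equals `|∑_i x_i e^{-2πi i t}|²`
(`normSq_signalDTFT`), so the power spectrum consists of its samples at the points `p / m`, while
the covariance matrix is the Toeplitz matrix with symbol `f_m`. A Toeplitz matrix of size `m` and
bandwidth `K` is a compression of a circulant matrix of size `m + K`, which is diagonal in the
Fourier basis with the samples of the symbol on the grid of `m + K` points as eigenvalues
(`toeplitzForm_indicator_eq`). Spectra are compared through their counting functions: if a form is
dominated by a diagonal form pulled back along an isometry, then it has no more eigenvalues above
any level than the diagonal form has entries (`card_filter_le_of_form_le`).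

Uniform case. Cutting the symbol at `|k| < K` costs `ε` uniformly. The compression then shows
that, up to shifts of the level by `O(ε)`, the covariance matrix has at most `K` more
eigenvalues above a level than there are samples `f_m(p / m)` above it. Neighbouring samples of
the band part differ by `O(1 / m)`, so by discrete continuity lowering the level by `O(K / m)`
makes up for these `K` indices (`card_filter_add_le`, `card_filter_le_card_samples`). The same
for the negatives gives the other inequality, and the sorted lists are uniformly close.

Mean case. Convergence of `c_0(x^{(m)})` says that the signal is square-summable. Split it as
`x = y + z` with `y` the first `K` samples. Since `|u + w|² ≤ (1 + δ) |u|² + (1 + δ⁻¹) |w|²`, both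
`C_x` and `C_y` are below `(1 + δ) C_y + (1 + δ⁻¹) C_z`, and likewise for power spectra. For
dominated lists the `ℓ¹` distance after sorting is a difference of traces, which is
`m` times a combination of energies and therefore small relative to `m`
(`sum_abs_sort_eigenvalues_sub_le`, `sum_abs_sort_powerSpectrum_sub_le`). The signal `y` has finite
support, so the uniform case applies to it.
-/

/-! ### Counting eigenvalues by comparing quadratic forms -/

/-- If the diagonal form with entries `a` is dominated by the pullback of the diagonal form with
entries `d` under an isometric embedding `W`, then `a` has at most as many entries `≥ t` as `d`.
Otherwise some nonzero `v` supported on `{t ≤ a}` has `W v` supported on `{d < t}`, and the two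
forms are on opposite sides of `t ‖v‖²`. This single statement replaces Weyl's monotonicity,
Cauchy interlacing and the comparison of a compression with the ambient spectrum. -/
lemma card_filter_le_of_form_le {ι κ : Type*} [Fintype ι] [Fintype κ]
    (a : ι → ℝ) (d : κ → ℝ) (W : (ι → ℂ) →ₗ[ℂ] (κ → ℂ))
    (hW : ∀ v, ∑ k, ‖W v k‖ ^ 2 = ∑ i, ‖v i‖ ^ 2)
    (h : ∀ v : ι → ℂ, ∑ i, a i * ‖v i‖ ^ 2 ≤ ∑ k, d k * ‖W v k‖ ^ 2) (t : ℝ) :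
    (Finset.univ.filter fun i => t ≤ a i).card ≤ (Finset.univ.filter fun k => t ≤ d k).card := by
  classical
  by_contra! hlt
  -- Extend by zero, apply `W`, restrict to `{t ≤ d}`: the target is smaller, so there is a kernel.
  let T : ({i // t ≤ a i} → ℂ) →ₗ[ℂ] ({k // t ≤ d k} → ℂ) :=
    (LinearMap.funLeft ℂ ℂ Subtype.val) ∘ₗ W ∘ₗ Function.ExtendByZero.linearMap ℂ Subtype.val
  have hker : LinearMap.ker T ≠ ⊥ := by
    apply LinearMap.ker_ne_bot_of_finrank_lt
    simpa [Fintype.card_subtype] using hlt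
  obtain ⟨w, hw, hw0⟩ := (Submodule.ne_bot_iff _).1 hker
  set u : ι → ℂ := Function.extend Subtype.val w 0 with hu
  have hWu : ∀ k, t ≤ d k → W u k = 0 := fun k hk => congrFun (LinearMap.mem_ker.1 hw) ⟨k, hk⟩
  have hu_low : ∀ i, ¬ t ≤ a i → u i = 0 := fun i hi =>
    Function.extend_apply' _ _ _ (by rintro ⟨j, rfl⟩; exact hi j.2)
  obtain ⟨j, hj⟩ := Function.ne_iff.1 hw0
  have huj : u j ≠ 0 := by rwa [hu, Subtype.val_injective.extend_apply]
  have hpos : 0 < ∑ i, ‖u i‖ ^ 2 :=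
    Finset.sum_pos' (fun _ _ => by positivity) ⟨j, Finset.mem_univ _, by positivity⟩
  have hlow : t * ∑ i, ‖u i‖ ^ 2 ≤ ∑ i, a i * ‖u i‖ ^ 2 := by
    rw [Finset.mul_sum]
    refine Finset.sum_le_sum fun i _ => ?_
    by_cases hi : t ≤ a i
    · gcongr
    · simp [hu_low i hi]
  have hhigh : ∑ k, d k * ‖W u k‖ ^ 2 < t * ∑ k, ‖W u k‖ ^ 2 := by
    rw [Finset.mul_sum]
    obtain ⟨k, -, hk⟩ := Finset.exists_ne_zero_of_sum_ne_zero ((hW u).trans_ne hpos.ne')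
    have hk' : W u k ≠ 0 := fun h0 => hk (by simp [h0])
    refine Finset.sum_lt_sum (fun k _ => ?_) ⟨k, Finset.mem_univ _, ?_⟩
    · by_cases hd : t ≤ d k
      · simp [hWu k hd]
      · have := (not_le.1 hd).le
        gcongr
    · have : d k < t := not_le.1 fun hd => hk' (hWu k hd)
      gcongr
  rw [hW] at hhigh
  linarith [h u]

/-! ### Sorted lists and counting functions -/

/-- A comparison of the counting functions of upper level sets, up to a shift by `ε`, is a
comparison of the lists sorted in increasing order. -/
lemma sort_le_sort_add {m : ℕ} (a b : Fin m → ℝ) (ε : ℝ)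
    (h : ∀ t, (Finset.univ.filter fun i => t ≤ a i).card ≤
      (Finset.univ.filter fun i => t - ε ≤ b i).card) (i : Fin m) :
    a (Tuple.sort a i) ≤ b (Tuple.sort b i) + ε := by
  by_contra! hlt
  have hcard : ∀ (f : Fin m → ℝ) (s : ℝ), (Finset.univ.filter fun j => s ≤ f j).card =
      (Finset.univ.filter fun j => s ≤ f (Tuple.sort f j)).card := fun f s =>
    (Finset.card_equiv (Tuple.sort f) (by simp)).symm
  have h1 := h (a (Tuple.sort a i))
  rw [hcard a, hcard b] at h1
  have h2 : Finset.Ici i ⊆ Finset.univ.filter fun j => a (Tuple.sort a i) ≤ a (Tuple.sort a j) :=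
    fun j hj => by simpa using Tuple.monotone_sort a (Finset.mem_Ici.1 hj)
  have h3 : (Finset.univ.filter fun j => a (Tuple.sort a i) - ε ≤ b (Tuple.sort b j)) ⊆
      Finset.Ioi i := fun j hj => by
    by_contra hji
    have := Tuple.monotone_sort b (not_lt.1 (mt Finset.mem_Ioi.2 hji))
    simp only [Function.comp_apply, Finset.mem_filter, Finset.mem_univ, true_and] at this hj
    linarith
  have h4 := (Finset.card_le_card h2).trans (h1.trans (Finset.card_le_card h3))
  rw [Fin.card_Ici, Fin.card_Ioi] at h4
  omega

/-- The counterpart of `sort_le_sort_add` for lower level sets. -/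
lemma sort_le_sort_add_of_card_le {m : ℕ} (a b : Fin m → ℝ) (ε : ℝ)
    (h : ∀ t, (Finset.univ.filter fun i => a i ≤ t).card ≤
      (Finset.univ.filter fun i => b i ≤ t + ε).card) (i : Fin m) :
    b (Tuple.sort b i) ≤ a (Tuple.sort a i) + ε := by
  by_contra! hlt
  have hcard : ∀ (f : Fin m → ℝ) (s : ℝ), (Finset.univ.filter fun j => f j ≤ s).card =
      (Finset.univ.filter fun j => f (Tuple.sort f j) ≤ s).card := fun f s =>
    (Finset.card_equiv (Tuple.sort f) (by simp)).symm
  have h1 := h (a (Tuple.sort a i))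
  rw [hcard a, hcard b] at h1
  have h2 : Finset.Iic i ⊆ Finset.univ.filter fun j => a (Tuple.sort a j) ≤ a (Tuple.sort a i) :=
    fun j hj => by simpa using Tuple.monotone_sort a (Finset.mem_Iic.1 hj)
  have h3 : (Finset.univ.filter fun j => b (Tuple.sort b j) ≤ a (Tuple.sort a i) + ε) ⊆
      Finset.Iio i := fun j hj => by
    by_contra hji
    have := Tuple.monotone_sort b (not_lt.1 (mt Finset.mem_Iio.2 hji))
    simp only [Function.comp_apply, Finset.mem_filter, Finset.mem_univ, true_and] at this hj
    linarith
  have h4 := (Finset.card_le_card h2).trans (h1.trans (Finset.card_le_card h3))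
  rw [Fin.card_Iic, Fin.card_Iio] at h4
  omega

/-- Domination of counting functions makes all differences of sorted entries have one sign, so
that their absolute sum is a difference of totals (of traces, for eigenvalues). -/
lemma sum_abs_sort_sub_sort {m : ℕ} (a b : Fin m → ℝ)
    (h : ∀ t, (Finset.univ.filter fun i => t ≤ a i).card ≤
      (Finset.univ.filter fun i => t ≤ b i).card) :
    ∑ i, |a (Tuple.sort a i) - b (Tuple.sort b i)| = ∑ i, b i - ∑ i, a i := by
  rw [← Equiv.sum_comp (Tuple.sort a) a, ← Equiv.sum_comp (Tuple.sort b) b,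
    ← Finset.sum_sub_distrib]
  refine Finset.sum_congr rfl fun i _ => ?_
  have := sort_le_sort_add a b 0 (by simpa using h) i
  rw [abs_sub_comm, abs_of_nonneg]
  linarith

/-! ### Counting samples of a slowly varying sequence -/

/-- If neighbouring values of `g` differ by at most `η`, then lowering a level by `K * η` gains
`K` indices, unless all are already counted: lowering it by `η` without a gain would mean that the
upper level set is closed under passing to neighbours. -/
lemma card_filter_add_le {m : ℕ} (g : Fin m → ℝ) (η : ℝ) (hη : 0 ≤ η)
    (hg : ∀ p q : Fin m, (p : ℕ) + 1 = q → |g p - g q| ≤ η) (s : ℝ)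
    (hs : (Finset.univ.filter fun p => s ≤ g p).Nonempty) (K : ℕ) :
    min m ((Finset.univ.filter fun p => s ≤ g p).card + K) ≤
      (Finset.univ.filter fun p => s - K * η ≤ g p).card := by
  induction K with
  | zero => simp
  | succ K ih =>
    set A := Finset.univ.filter fun p => s - K * η ≤ g p with hA
    set B := Finset.univ.filter fun p => s - (K + 1 : ℕ) * η ≤ g p with hB
    have hAB : A ⊆ B := fun p hp => by
      simp only [hA, hB, Finset.mem_filter, Finset.mem_univ, true_and] at hp ⊢
      push_cast
      linarith
    rcases hAB.eq_or_ssubset with heq | hss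
    · have hstep : ∀ p q : Fin m, |g p - g q| ≤ η → p ∈ A → q ∈ A := fun p q hpq hp => by
        rw [heq]
        simp only [hA, hB, Finset.mem_filter, Finset.mem_univ, true_and] at hp ⊢
        push_cast
        linarith [(abs_le.1 hpq).2]
      obtain ⟨p₀, hp₀⟩ := hs
      have hp₀A : p₀ ∈ A := by
        simp only [hA, Finset.mem_filter, Finset.mem_univ, true_and] at hp₀ ⊢
        have : 0 ≤ K * η := by positivity
        linarith
      -- No index was gained, so `A` is closed under neighbours and contains everything.
      have hup : ∀ n (hn : n < m), (p₀ : ℕ) ≤ n → (⟨n, hn⟩ : Fin m) ∈ A := fun n hn hle => by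
        induction n, hle using Nat.le_induction with
        | base => exact hp₀A
        | succ n _ ihn =>
          exact hstep ⟨n, by omega⟩ ⟨n + 1, hn⟩ (hg _ _ rfl) (ihn (by omega))
      have h0 : ∀ n (hn : n < m), n ≤ (p₀ : ℕ) → (⟨p₀ - n, by omega⟩ : Fin m) ∈ A := fun n hn => by
        induction n with
        | zero => exact fun _ => hp₀A
        | succ n ihn =>
          intro hle
          refine hstep ⟨p₀ - n, by omega⟩ _ ?_ (ihn (by omega) (by omega))
          rw [abs_sub_comm]
          exact hg _ _ (by simp only; omega)
      have hall : A = Finset.univ := by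
        ext p
        simp only [Finset.mem_univ, iff_true]
        rcases le_total (p₀ : ℕ) p with hle | hle
        · exact hup p p.2 hle
        · have := h0 (p₀ - p) (by omega) (by omega)
          convert this using 2
          omega
      rw [← heq, hall]
      simp
    · have := Finset.card_lt_card hss
      omega

/-! ### Toeplitz forms on a Fourier grid -/

lemma sum_exp_two_pi_mul_div (N : ℕ) (n : ℤ) (hn : |n| < N) :
    ∑ k : Fin N, Complex.exp ((2 * Real.pi * n * ((k : ℕ) / N : ℝ) : ℝ) * Complex.I) =
      if n = 0 then (N : ℂ) else 0 := by
  have hN : (N : ℂ) ≠ 0 := by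
    have : 0 < N := by have := abs_nonneg n; omega
    exact_mod_cast this.ne'
  split_ifs with h0
  · simp [h0]
  · set z := Complex.exp (2 * Real.pi * Complex.I * n / N) with hz
    have hpow : ∀ k : Fin N,
        Complex.exp ((2 * Real.pi * n * ((k : ℕ) / N : ℝ) : ℝ) * Complex.I) = z ^ (k : ℕ) := by
      intro k
      rw [hz, ← Complex.exp_nat_mul]
      congr 1
      push_cast
      field_simp
    have hz1 : z ≠ 1 := by
      rw [hz, Ne, Complex.exp_eq_one_iff]
      rintro ⟨q, hq⟩
      have hq' : (n : ℂ) = q * N := by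
        have := Complex.two_pi_I_ne_zero
        field_simp at hq
        linear_combination hq
      have : n = q * N := by exact_mod_cast hq'
      exact h0 (Int.eq_zero_of_abs_lt_dvd ⟨q, by rw [this]; ring⟩ hn)
    have hzN : z ^ N = 1 := by
      rw [hz, ← Complex.exp_nat_mul, Complex.exp_eq_one_iff]
      exact ⟨n, by field_simp⟩
    rw [Finset.sum_congr rfl fun k _ => hpow k, Fin.sum_univ_eq_sum_range (fun k => z ^ k),
      geom_sum_eq hz1, hzN]
    simp

/-- The trigonometric polynomial `∑_{l ∈ S} c_l e^{-2πi l t}`, the symbol of the Toeplitz matrix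
with entries `c_{j-i}` restricted to the differences in `S`. -/
noncomputable def trigPoly (S : Finset ℤ) (c : ℤ → ℂ) (t : ℝ) : ℂ :=
  ∑ l ∈ S, c l * Complex.exp ((-(2 * Real.pi * l * t) : ℝ) * Complex.I)

/-- The sesquilinear form `v* T v` of the Toeplitz matrix `T` with entries `c_{j-i}`. -/
noncomputable def toeplitzForm {m : ℕ} (c : ℤ → ℂ) (v : Fin m → ℂ) : ℂ :=
  ∑ i : Fin m, ∑ j : Fin m, (starRingEnd ℂ) (v i) * c ((j : ℤ) - (i : ℤ)) * v j

/-- The discrete Fourier transform of length `N` of a vector of length `m` padded with zeros,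
scaled by `N^{-1/2}`; an isometric embedding when `m ≤ N`. -/
noncomputable def fourierGrid (m N : ℕ) : (Fin m → ℂ) →ₗ[ℂ] (Fin N → ℂ) where
  toFun v k := ((Real.sqrt N)⁻¹ : ℝ) *
    ∑ i : Fin m, v i * Complex.exp ((2 * Real.pi * (i : ℕ) * ((k : ℕ) / N : ℝ) : ℝ) * Complex.I)
  map_add' v w := by
    funext k
    simp only [Pi.add_apply, add_mul, Finset.sum_add_distrib, mul_add]
  map_smul' r v := by
    funext k
    simp only [Pi.smul_apply, smul_eq_mul, RingHom.id_apply, Finset.mul_sum]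
    exact Finset.sum_congr rfl fun i _ => by ring

lemma normSq_fourierGrid {m N : ℕ} (v : Fin m → ℂ) (k : Fin N) :
    ((‖fourierGrid m N v k‖ ^ 2 : ℝ) : ℂ) = (N : ℂ)⁻¹ * ∑ i : Fin m, ∑ j : Fin m,
      (starRingEnd ℂ) (v i) * v j *
        Complex.exp ((2 * Real.pi * ((j : ℤ) - (i : ℤ) : ℤ) * ((k : ℕ) / N : ℝ) : ℝ) *
          Complex.I) := by
  have hs : (((Real.sqrt N)⁻¹ : ℝ) : ℂ) * ((Real.sqrt N)⁻¹ : ℝ) = (N : ℂ)⁻¹ := by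
    rw [← Complex.ofReal_mul, ← mul_inv, Real.mul_self_sqrt (Nat.cast_nonneg N)]
    push_cast
    rfl
  rw [Complex.ofReal_pow, ← Complex.conj_mul']
  change (starRingEnd ℂ) (_ * _) * (_ * _) = _
  rw [map_mul, Complex.conj_ofReal, mul_mul_mul_comm, hs, map_sum, Finset.sum_mul_sum]
  congr 1
  refine Finset.sum_congr rfl fun i _ => Finset.sum_congr rfl fun j _ => ?_
  rw [map_mul, ← Complex.exp_conj, mul_mul_mul_comm, ← Complex.exp_add]
  congr 2
  simp only [map_mul, Complex.conj_ofReal, Complex.conj_I]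
  push_cast
  ring

/-- Orthogonality of characters of `ℤ/N`: the hypothesis excludes aliasing. -/
lemma sum_trigPoly_mul_exp (S : Finset ℤ) (c : ℤ → ℂ) (N : ℕ) (n : ℤ)
    (hS : ∀ l ∈ S, |n - l| < N) :
    ∑ k : Fin N, trigPoly S c ((k : ℕ) / N) *
      Complex.exp ((2 * Real.pi * n * ((k : ℕ) / N : ℝ) : ℝ) * Complex.I) =
      N * if n ∈ S then c n else 0 := by
  have h1 : ∀ k : Fin N, trigPoly S c ((k : ℕ) / N) *
      Complex.exp ((2 * Real.pi * n * ((k : ℕ) / N : ℝ) : ℝ) * Complex.I) = ∑ l ∈ S, c l *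
        Complex.exp ((2 * Real.pi * (n - l : ℤ) * ((k : ℕ) / N : ℝ) : ℝ) * Complex.I) := by
    intro k
    rw [trigPoly, Finset.sum_mul]
    refine Finset.sum_congr rfl fun l _ => ?_
    rw [mul_assoc, ← Complex.exp_add]
    congr 2
    push_cast
    ring
  rw [Finset.sum_congr rfl fun k _ => h1 k, Finset.sum_comm]
  have h2 : ∀ l ∈ S, ∑ k : Fin N, c l *
      Complex.exp ((2 * Real.pi * (n - l : ℤ) * ((k : ℕ) / N : ℝ) : ℝ) * Complex.I) =
      if n = l then N * c l else 0 := by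
    intro l hl
    rw [← Finset.mul_sum, sum_exp_two_pi_mul_div N _ (hS l hl)]
    simp only [sub_eq_zero]
    split_ifs <;> ring
  rw [Finset.sum_congr rfl h2, Finset.sum_ite_eq]
  split_ifs <;> simp

/-- A Toeplitz matrix of size `m` is a compression of the circulant matrix of size `N` with the
same symbol, as soon as `N` exceeds `m` by the bandwidth; hence its form is diagonal on the grid
of `N` points, with the samples of the symbol as entries. -/
lemma toeplitzForm_indicator_eq {m N : ℕ} (S : Finset ℤ) (c : ℤ → ℂ)
    (hS : ∀ l ∈ S, |l| + m ≤ N) (v : Fin m → ℂ) :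
    toeplitzForm (fun l => if l ∈ S then c l else 0) v =
      ∑ k : Fin N, trigPoly S c ((k : ℕ) / N) * ((‖fourierGrid m N v k‖ ^ 2 : ℝ) : ℂ) := by
  simp only [normSq_fourierGrid, toeplitzForm]
  simp only [Finset.mul_sum]
  conv_rhs => rw [Finset.sum_comm]
  refine Finset.sum_congr rfl fun i _ => ?_
  conv_rhs => rw [Finset.sum_comm]
  refine Finset.sum_congr rfl fun j _ => ?_
  have h := sum_trigPoly_mul_exp S c N ((j : ℤ) - (i : ℤ)) fun l hl => by
    have := hS l hl
    have h1 : |((j : ℤ) - (i : ℤ)) - l| ≤ |((j : ℤ) - (i : ℤ))| + |l| := abs_sub _ _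
    have h2 : |((j : ℤ) - (i : ℤ))| < m := by rw [abs_lt]; omega
    omega
  by_cases hN : N = 0
  · subst hN
    have : ((j : ℤ) - (i : ℤ)) ∉ S := fun hl => by
      have := hS _ hl
      have := abs_nonneg ((j : ℤ) - (i : ℤ))
      have := i.2
      omega
    simp [this]
  · have hN' : (N : ℂ) ≠ 0 := by exact_mod_cast hN
    rw [show (if ((j : ℤ) - (i : ℤ)) ∈ S then c ((j : ℤ) - (i : ℤ)) else 0) =
      (N : ℂ)⁻¹ * (N * if ((j : ℤ) - (i : ℤ)) ∈ S then c ((j : ℤ) - (i : ℤ)) else 0) by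
        rw [inv_mul_cancel_left₀ hN'], ← h]
    simp only [Finset.mul_sum, Finset.sum_mul]
    refine Finset.sum_congr rfl fun k _ => ?_
    ring

lemma sum_normSq_fourierGrid {m N : ℕ} (hmN : m ≤ N) (v : Fin m → ℂ) :
    ∑ k, ‖fourierGrid m N v k‖ ^ 2 = ∑ i, ‖v i‖ ^ 2 := by
  have h := toeplitzForm_indicator_eq (N := N) {0} 1 (by simpa using hmN) v
  have h0 : ∀ i j : Fin m, (j : ℤ) - (i : ℤ) = 0 ↔ i = j := fun i j => by
    rw [Fin.ext_iff]; omega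
  simp only [toeplitzForm, trigPoly, Finset.mem_singleton, h0] at h
  simp only [Pi.one_apply, mul_ite, mul_one, mul_zero, ite_mul, zero_mul, Finset.sum_ite_eq,
    Finset.mem_univ, if_true, Finset.sum_singleton, Complex.conj_mul'] at h
  simp at h
  exact_mod_cast h.symm

/-! ### Toeplitz eigenvalues against samples of the symbol -/

lemma norm_trigPoly_le (S : Finset ℤ) (c : ℤ → ℂ) (t : ℝ) :
    ‖trigPoly S c t‖ ≤ ∑ l ∈ S, ‖c l‖ := by
  refine (norm_sum_le _ _).trans (Finset.sum_le_sum fun l _ => ?_)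
  rw [norm_mul, Complex.norm_exp_ofReal_mul_I, mul_one]

lemma norm_trigPoly_sub_le (S : Finset ℤ) (c : ℤ → ℂ) (K : ℕ) (hS : ∀ l ∈ S, |l| ≤ K) (s t : ℝ) :
    ‖trigPoly S c s - trigPoly S c t‖ ≤ 2 * Real.pi * K * (∑ l ∈ S, ‖c l‖) * |s - t| := by
  rw [trigPoly, trigPoly, ← Finset.sum_sub_distrib, Finset.mul_sum, Finset.sum_mul]
  refine (norm_sum_le _ _).trans (Finset.sum_le_sum fun l hl => ?_)
  have h1 : c l * Complex.exp ((-(2 * Real.pi * l * s) : ℝ) * Complex.I) -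
      c l * Complex.exp ((-(2 * Real.pi * l * t) : ℝ) * Complex.I) =
      c l * Complex.exp ((-(2 * Real.pi * l * t) : ℝ) * Complex.I) *
        (Complex.exp (Complex.I * (-(2 * Real.pi * l * (s - t)) : ℝ)) - 1) := by
    have h2 : Complex.exp ((-(2 * Real.pi * l * s) : ℝ) * Complex.I) =
        Complex.exp ((-(2 * Real.pi * l * t) : ℝ) * Complex.I) *
          Complex.exp (Complex.I * (-(2 * Real.pi * l * (s - t)) : ℝ)) := by
      rw [← Complex.exp_add]
      congr 1
      push_cast
      ring
    rw [h2]
    ring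
  rw [h1, norm_mul, norm_mul, Complex.norm_exp_ofReal_mul_I, mul_one]
  have h2 : |(l : ℝ)| ≤ K := by exact_mod_cast hS l hl
  calc ‖c l‖ * ‖Complex.exp (Complex.I * (-(2 * Real.pi * l * (s - t)) : ℝ)) - 1‖
      ≤ ‖c l‖ * ‖-(2 * Real.pi * l * (s - t))‖ := by
        gcongr
        exact Real.norm_exp_I_mul_ofReal_sub_one_le
    _ = 2 * Real.pi * |(l : ℝ)| * ‖c l‖ * |s - t| := by
        rw [norm_neg, norm_mul, norm_mul, Real.norm_of_nonneg (by positivity), Real.norm_eq_abs,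
          Real.norm_eq_abs]
        ring
    _ ≤ _ := by gcongr

lemma card_filter_add_le_add {m K : ℕ} (P : Fin (m + K) → Prop) [DecidablePred P] :
    (Finset.univ.filter P).card ≤
      (Finset.univ.filter fun p : Fin m => P (Fin.castAdd K p)).card + K := by
  rw [Finset.card_filter, Fin.sum_univ_add, ← Finset.card_filter, ← Finset.card_filter]
  gcongr
  exact (Finset.card_le_univ _).trans (by simp)

/-- The counting function of the spectrum `a` of a Toeplitz form is bounded by that of the samples
of its symbol at `p / m`, up to a shift by `4 ε`. The symbol is cut at the band `|l| < K`, which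
costs `ε`. The band form is a compression of a circulant of size `m + K`; its extra `K` grid
points are absorbed by `card_filter_add_le`, since neighbouring samples differ by `O(1 / m)`.
Stated for `a` and `U` instead of a matrix so that it also applies to the negatives of the
eigenvalues. -/
lemma card_filter_le_card_samples {m : ℕ} (c : ℤ → ℂ) (a : Fin m → ℝ)
    (U : (Fin m → ℂ) →ₗ[ℂ] (Fin m → ℂ)) (hU : ∀ v, ∑ k, ‖U v k‖ ^ 2 = ∑ i, ‖v i‖ ^ 2)
    (hform : ∀ v, ∑ i, a i * ‖v i‖ ^ 2 = (toeplitzForm c (U v)).re) (M ε : ℝ) (K : ℕ)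
    (hM : ∑ l ∈ Finset.Ioo (-(m : ℤ)) m, ‖c l‖ ≤ M)
    (htail : ∑ l ∈ Finset.Ioo (-(m : ℤ)) m with (K : ℤ) ≤ |l|, ‖c l‖ ≤ ε)
    (hm : 2 * Real.pi * K * M * (K + 1) ≤ ε * m) (t : ℝ) :
    (Finset.univ.filter fun i => t ≤ a i).card ≤ (Finset.univ.filter fun p : Fin m =>
      t - 4 * ε ≤ (trigPoly (Finset.Ioo (-(m : ℤ)) m) c ((p : ℕ) / m)).re).card := by
  rcases Nat.eq_zero_or_pos m with rfl | hmpos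
  · simp
  have hm0 : (0 : ℝ) < m := by exact_mod_cast hmpos
  have hM0 : 0 ≤ M := (Finset.sum_nonneg fun _ _ => norm_nonneg _).trans hM
  have hε0 : 0 ≤ ε := (Finset.sum_nonneg fun _ _ => norm_nonneg _).trans htail
  set I := Finset.Ioo (-(m : ℤ)) m with hI
  set S := I.filter fun l => ¬ (K : ℤ) ≤ |l| with hS
  set R := I.filter fun l => (K : ℤ) ≤ |l| with hR
  have hsplit : ∀ s, trigPoly I c s = trigPoly R c s + trigPoly S c s := fun s =>
    (Finset.sum_filter_add_sum_filter_not I (fun l => (K : ℤ) ≤ |l|) _).symm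
  have hRε : ∀ s, |(trigPoly R c s).re| ≤ ε := fun s =>
    (Complex.abs_re_le_norm _).trans ((norm_trigPoly_le R c s).trans htail)
  have hSK : ∀ l ∈ S, |l| ≤ K := fun l hl => (not_le.1 (Finset.mem_filter.1 hl).2).le
  have hSM : ∑ l ∈ S, ‖c l‖ ≤ M :=
    (Finset.sum_le_sum_of_subset_of_nonneg (Finset.filter_subset _ _)
      fun _ _ _ => norm_nonneg _).trans hM
  have hlip : ∀ s r : ℝ, |(trigPoly S c s).re - (trigPoly S c r).re| ≤
      2 * Real.pi * K * M * |s - r| := fun s r => by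
    rw [← Complex.sub_re]
    refine (Complex.abs_re_le_norm _).trans ((norm_trigPoly_sub_le S c K hSK s r).trans ?_)
    gcongr
  -- The form of the band part is diagonal on the grid of `m + K` points.
  have hband : ∀ v : Fin m → ℂ, (toeplitzForm c v).re ≤ ∑ k : Fin (m + K),
      ((trigPoly S c ((k : ℕ) / (m + K : ℕ))).re + ε) * ‖fourierGrid m (m + K) v k‖ ^ 2 := by
    intro v
    have hadd : toeplitzForm c v = toeplitzForm (fun l => if l ∈ S then c l else 0) v +
        toeplitzForm (fun l => if l ∈ R then c l else 0) v := by
      simp only [toeplitzForm, ← Finset.sum_add_distrib]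
      refine Finset.sum_congr rfl fun i _ => Finset.sum_congr rfl fun j _ => ?_
      have hmem : (j : ℤ) - (i : ℤ) ∈ I := by rw [hI, Finset.mem_Ioo]; omega
      rw [← add_mul, ← mul_add]
      by_cases hK : (K : ℤ) ≤ |(j : ℤ) - (i : ℤ)| <;> simp [hS, hR, hmem, hK]
    -- On the grid of `2 m` points there is no aliasing for any difference of indices.
    have hrem : (toeplitzForm (fun l => if l ∈ R then c l else 0) v).re ≤
        ε * ∑ i, ‖v i‖ ^ 2 := by
      rw [toeplitzForm_indicator_eq (N := m + m) R c (fun l hl => by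
          have := Finset.mem_Ioo.1 (Finset.mem_filter.1 hl).1
          have : |l| ≤ m := abs_le.2 ⟨by omega, by omega⟩
          push_cast
          omega) v, Complex.re_sum, ← sum_normSq_fourierGrid (Nat.le_add_right m m),
        Finset.mul_sum]
      refine Finset.sum_le_sum fun k _ => ?_
      rw [Complex.re_mul_ofReal]
      gcongr
      exact (abs_le.1 (hRε _)).2
    rw [hadd, Complex.add_re, toeplitzForm_indicator_eq (N := m + K) S c (fun l hl => by
        have := hSK l hl
        push_cast
        omega) v, Complex.re_sum]
    simp only [add_mul, Finset.sum_add_distrib, ← Finset.mul_sum,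
      sum_normSq_fourierGrid (Nat.le_add_right m K), Complex.re_mul_ofReal]
    gcongr
  have hcount := card_filter_le_of_form_le a
    (fun k : Fin (m + K) => (trigPoly S c ((k : ℕ) / (m + K : ℕ))).re + ε)
    (fourierGrid m (m + K) ∘ₗ U)
    (fun v => (sum_normSq_fourierGrid (Nat.le_add_right m K) _).trans (hU v))
    (fun v => (hform v).trans_le (hband (U v))) t
  -- The band symbol varies by at most `ε` between grid points at distance at most `(K + 1) / m`.
  have hnear : ∀ (k : Fin (m + K)) (p : Fin m),
      |((k : ℕ) / (m + K : ℕ) : ℝ) - (p : ℕ) / m| ≤ (K + 1) / m →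
      |(trigPoly S c ((k : ℕ) / (m + K : ℕ))).re - (trigPoly S c ((p : ℕ) / m)).re| ≤ ε := by
    intro k p h
    refine (hlip _ _).trans ?_
    calc 2 * Real.pi * K * M * |((k : ℕ) / (m + K : ℕ) : ℝ) - (p : ℕ) / m|
        ≤ 2 * Real.pi * K * M * ((K + 1) / m) := by gcongr
      _ ≤ ε := by rw [← mul_div_assoc, div_le_iff₀ hm0]; exact hm
  set s := t - 2 * ε with hs
  set G : Fin m → ℝ := fun p => (trigPoly S c ((p : ℕ) / m)).re with hG
  have hcast : ∀ p : Fin m,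
      |((Fin.castAdd K p : ℕ) / (m + K : ℕ) : ℝ) - (p : ℕ) / m| ≤ (K + 1) / m := fun p => by
    have hp : ((p : ℕ) : ℝ) ≤ m := by exact_mod_cast p.2.le
    rw [Fin.val_castAdd, abs_sub_comm]
    have : ((p : ℕ) : ℝ) / m - (p : ℕ) / (m + K : ℕ) = ((p : ℕ) / (m + K : ℕ)) * (K / m) := by
      push_cast
      field_simp
      ring
    rw [this, abs_of_nonneg (by positivity)]
    have h1 : ((p : ℕ) : ℝ) / (m + K : ℕ) ≤ 1 := by
      rw [div_le_one (by positivity)]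
      push_cast
      linarith [(Nat.cast_nonneg K : (0 : ℝ) ≤ K)]
    calc ((p : ℕ) : ℝ) / (m + K : ℕ) * (K / m) ≤ 1 * ((K + 1) / m) := by
          gcongr
          linarith
      _ = _ := one_mul _
  rcases (Finset.univ.filter fun i => t ≤ a i).eq_empty_or_nonempty with hemp | hne
  · simp [hemp]
  have hcardK : (Finset.univ.filter fun i => t ≤ a i).card ≤
      (Finset.univ.filter fun p => s ≤ G p).card + K := by
    refine hcount.trans ((card_filter_add_le_add _).trans ?_)
    refine Nat.add_le_add_right (Finset.card_le_card fun p hp => ?_) K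
    have h1 := (abs_le.1 (hnear _ p (hcast p))).2
    have h2 := (Finset.mem_filter.1 hp).2
    simp only [Finset.mem_filter, Finset.mem_univ, true_and, hG, hs]
    linarith
  -- The gap argument needs one sample above the level `s`; a grid point
  -- above `t - ε` has one nearby.
  have hGne : (Finset.univ.filter fun p => s ≤ G p).Nonempty := by
    obtain ⟨k, hk⟩ := Finset.card_pos.1 ((Finset.card_pos.2 hne).trans_le hcount)
    have hk' := (Finset.mem_filter.1 hk).2
    suffices ∃ p : Fin m, |((k : ℕ) / (m + K : ℕ) : ℝ) - (p : ℕ) / m| ≤ (K + 1) / m by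
      obtain ⟨p, hp⟩ := this
      refine ⟨p, ?_⟩
      have := (abs_le.1 (hnear k p hp)).2
      simp only [Finset.mem_filter, Finset.mem_univ, true_and, hG, hs]
      linarith
    by_cases hkm : (k : ℕ) < m
    · exact ⟨⟨k, hkm⟩, hcast ⟨k, hkm⟩⟩
    · refine ⟨⟨m - 1, by omega⟩, ?_⟩
      -- The surplus points `k ≥ m` lie within `K / m` of `1`, hence near the last point `(m-1)/m`.
      have h1 : (m : ℝ) ≤ (k : ℕ) := by exact_mod_cast not_lt.1 hkm
      have h2 : ((k : ℕ) : ℝ) ≤ m + K := by exact_mod_cast k.2.le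
      have hmK : (0 : ℝ) < m + K := by positivity
      have h3 : ((k : ℕ) : ℝ) / (m + K) ≤ 1 := (div_le_one hmK).2 h2
      have h4 : 1 - (K : ℝ) / m ≤ (k : ℕ) / (m + K) := by
        rw [le_div_iff₀ hmK]
        have : (1 - (K : ℝ) / m) * (m + K) = m - K * (K / m) := by
          field_simp
          ring
        rw [this]
        have : 0 ≤ (K : ℝ) * (K / m) := by positivity
        linarith
      have h5 : ((m - 1 : ℕ) : ℝ) / m = 1 - 1 / m := by
        rw [Nat.cast_sub hmpos]
        push_cast
        field_simp
      push_cast at h5 ⊢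
      rw [h5, abs_le, add_div]
      have h6 : (0 : ℝ) ≤ 1 / m := by positivity
      have h7 : (0 : ℝ) ≤ K / m := by positivity
      constructor <;> linarith
  have hgap := card_filter_add_le G (2 * Real.pi * K * M / m) (by positivity)
    (fun p q hpq => by
      refine (hlip _ _).trans ?_
      rw [← hpq, ← sub_div, div_eq_mul_inv _ (m : ℝ)]
      push_cast
      rw [sub_add_cancel_left, abs_mul, abs_neg, abs_one, one_mul, abs_of_pos (inv_pos.2 hm0),
        div_eq_mul_inv]) s hGne K
  have hKη : K * (2 * Real.pi * K * M / m) ≤ ε := by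
    rw [← mul_div_assoc, div_le_iff₀ hm0]
    refine le_trans ?_ hm
    have : 0 ≤ 2 * Real.pi * K * M := by positivity
    linarith
  refine le_trans ?_ (hgap.trans (Finset.card_le_card ?_))
  · refine le_min ((Finset.card_le_univ _).trans (by simp)) hcardK
  · intro p hp
    have h1 := (Finset.mem_filter.1 hp).2
    have h2 := (abs_le.1 (hRε ((p : ℕ) / m))).1
    simp only [Finset.mem_filter, Finset.mem_univ, true_and, hsplit, Complex.add_re]
    simp only [hG, hs] at h1
    linarith

/-! ### Eigenvalues of Hermitian matrices -/

lemma star_dotProduct_self_eq_sum {ι : Type*} [Fintype ι] (v : ι → ℂ) :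
    star v ⬝ᵥ v = ((∑ i, ‖v i‖ ^ 2 : ℝ) : ℂ) := by
  simp [dotProduct, Complex.conj_mul']

lemma sum_normSq_toLin'_of_star_mul_self {ι : Type*} [Fintype ι] [DecidableEq ι]
    (V : Matrix ι ι ℂ) (hV : star V * V = 1) (v : ι → ℂ) :
    ∑ i, ‖Matrix.toLin' V v i‖ ^ 2 = ∑ i, ‖v i‖ ^ 2 := by
  have h : star (V.mulVec v) ⬝ᵥ V.mulVec v = star v ⬝ᵥ v := by
    rw [Matrix.star_mulVec, ← Matrix.dotProduct_mulVec, Matrix.mulVec_mulVec,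
      ← Matrix.star_eq_conjTranspose, hV, Matrix.one_mulVec]
  rw [star_dotProduct_self_eq_sum, star_dotProduct_self_eq_sum] at h
  exact_mod_cast h

lemma sum_eigenvalues_mul_normSq {ι : Type*} [Fintype ι] [DecidableEq ι] {A : Matrix ι ι ℂ}
    (hA : A.IsHermitian) (v : ι → ℂ) :
    ∑ i, hA.eigenvalues i * ‖v i‖ ^ 2 =
      (star (Matrix.toLin' (hA.eigenvectorUnitary : Matrix ι ι ℂ) v) ⬝ᵥ
        A.mulVec (Matrix.toLin' (hA.eigenvectorUnitary : Matrix ι ι ℂ) v)).re := by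
  have h := hA.conjStarAlgAut_star_eigenvectorUnitary
  rw [Unitary.conjStarAlgAut_star_apply] at h
  rw [Matrix.toLin'_apply, Matrix.star_mulVec, ← Matrix.dotProduct_mulVec, Matrix.mulVec_mulVec,
    Matrix.mulVec_mulVec, ← Matrix.star_eq_conjTranspose, h, dotProduct, Complex.re_sum]
  refine Finset.sum_congr rfl fun i _ => ?_
  rw [Matrix.mulVec_diagonal, mul_left_comm]
  simp only [Pi.star_apply, Complex.star_def, Complex.conj_mul', Function.comp_apply]
  rw [← Complex.ofReal_pow, Complex.re_mul_ofReal]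
  rfl

lemma card_le_eigenvalues_mono {ι : Type*} [Fintype ι] [DecidableEq ι] {A B : Matrix ι ι ℂ}
    (hA : A.IsHermitian) (hB : B.IsHermitian)
    (h : ∀ v, (star v ⬝ᵥ A.mulVec v).re ≤ (star v ⬝ᵥ B.mulVec v).re) (t : ℝ) :
    (Finset.univ.filter fun i => t ≤ hA.eigenvalues i).card ≤
      (Finset.univ.filter fun i => t ≤ hB.eigenvalues i).card := by
  set UA := (hA.eigenvectorUnitary : Matrix ι ι ℂ)
  set UB := (hB.eigenvectorUnitary : Matrix ι ι ℂ) with hUB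
  have hUA : star UA * UA = 1 := Unitary.coe_star_mul_self _
  have hUB'' : UB * star UB = 1 := Unitary.coe_mul_star_self _
  have hUB' : star (star UB) * star UB = 1 := by rwa [star_star]
  refine card_filter_le_of_form_le _ _ (Matrix.toLin' (star UB) ∘ₗ Matrix.toLin' UA)
    (fun v => (sum_normSq_toLin'_of_star_mul_self _ hUB' _).trans
      (sum_normSq_toLin'_of_star_mul_self _ hUA v)) (fun v => ?_) t
  rw [sum_eigenvalues_mul_normSq hA, sum_eigenvalues_mul_normSq hB, LinearMap.comp_apply]
  have : Matrix.toLin' UB (Matrix.toLin' (star UB) (Matrix.toLin' UA v)) = Matrix.toLin' UA v := by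
    simp only [Matrix.toLin'_apply, Matrix.mulVec_mulVec]
    rw [← Matrix.mul_assoc, hUB'', Matrix.one_mul]
  rw [← hUB, this]
  exact h _

/-- Two lists below a common list `q` (in the sense of counting functions) are close in `ℓ¹` after
sorting if all three totals are close. -/
lemma sum_abs_sort_sub_sort_le {m : ℕ} (a b q : Fin m → ℝ)
    (ha : ∀ t, (Finset.univ.filter fun i => t ≤ a i).card ≤
      (Finset.univ.filter fun i => t ≤ q i).card)
    (hb : ∀ t, (Finset.univ.filter fun i => t ≤ b i).card ≤
      (Finset.univ.filter fun i => t ≤ q i).card) :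
    ∑ i, |a (Tuple.sort a i) - b (Tuple.sort b i)| ≤ 2 * ∑ i, q i - ∑ i, a i - ∑ i, b i := by
  have h1 := sum_abs_sort_sub_sort a q ha
  have h2 := sum_abs_sort_sub_sort b q hb
  have h3 : ∑ i, |a (Tuple.sort a i) - b (Tuple.sort b i)| ≤
      ∑ i, (|a (Tuple.sort a i) - q (Tuple.sort q i)| +
        |b (Tuple.sort b i) - q (Tuple.sort q i)|) := by
    refine Finset.sum_le_sum fun i _ => ?_
    rw [abs_sub_comm (b _)]
    exact abs_sub_le _ _ _
  rw [Finset.sum_add_distrib] at h3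
  linarith

/-! ### Autocorrelations, the covariance matrix and the power spectrum -/

lemma autocorr_neg {m : ℕ} (x : Fin m → ℂ) (k : ℤ) :
    autocorr x (-k) = (starRingEnd ℂ) (autocorr x k) := by
  rw [autocorr, autocorr, map_sum]
  refine Finset.sum_equiv (Equiv.prodComm _ _) (fun p => ?_) fun p _ => ?_
  · simp only [Finset.mem_filter, Finset.mem_univ, true_and, Equiv.prodComm_apply, Prod.fst_swap,
      Prod.snd_swap]
    omega
  · simp [mul_comm]

lemma covMatrix_isHermitian {m : ℕ} (x : Fin m → ℂ) : (covMatrix x).IsHermitian := by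
  ext i j
  rw [Matrix.conjTranspose_apply, covMatrix, Matrix.of_apply, Matrix.of_apply, ← neg_sub,
    autocorr_neg, Complex.star_def, Complex.conj_conj]

/-- The eigenvalues of the covariance matrix, in Mathlib's order. -/
noncomputable def covEigenvalues {m : ℕ} (x : Fin m → ℂ) : Fin m → ℝ :=
  (covMatrix_isHermitian x).eigenvalues

lemma star_dotProduct_covMatrix_mulVec {m : ℕ} (x v : Fin m → ℂ) :
    star v ⬝ᵥ (covMatrix x).mulVec v = toeplitzForm (autocorr x) v := by
  simp only [dotProduct, Matrix.mulVec, toeplitzForm, Finset.mul_sum, covMatrix, Matrix.of_apply,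
    Pi.star_apply, Complex.star_def, mul_assoc]

lemma autocorr_zero {m : ℕ} (x : Fin m → ℂ) : autocorr x 0 = ((∑ i, ‖x i‖ ^ 2 : ℝ) : ℂ) := by
  have h0 : ∀ i j : Fin m, (i : ℤ) - (j : ℤ) = 0 ↔ i = j := fun i j => by
    rw [Fin.ext_iff]; omega
  rw [autocorr, Finset.sum_filter, Fintype.sum_prod_type]
  simp [h0, Complex.mul_conj']

lemma trace_covMatrix {m : ℕ} (x : Fin m → ℂ) :
    (covMatrix x).trace = ((m * ∑ i, ‖x i‖ ^ 2 : ℝ) : ℂ) := by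
  simp [Matrix.trace, covMatrix, autocorr_zero]

lemma Matrix.IsHermitian.sum_eigenvalues_eq_of_trace {ι : Type*} [Fintype ι] [DecidableEq ι]
    {A : Matrix ι ι ℂ} (hA : A.IsHermitian) {r : ℝ} (h : A.trace = r) :
    ∑ i, hA.eigenvalues i = r := by
  rw [hA.trace_eq_sum_eigenvalues] at h
  simpa using congrArg Complex.re h

lemma sum_covEigenvalues {m : ℕ} (x : Fin m → ℂ) :
    ∑ i, covEigenvalues x i = m * ∑ i, ‖x i‖ ^ 2 :=
  Matrix.IsHermitian.sum_eigenvalues_eq_of_trace _ (trace_covMatrix x)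

/-- The Fourier transform `∑_{i=1}^m x_i e^{-2πi i t}` of a signal at an arbitrary frequency `t`;
the entry `x_i` is `x (i-1)` here. -/
noncomputable def signalDTFT {m : ℕ} (x : Fin m → ℂ) (t : ℝ) : ℂ :=
  ∑ i : Fin m, x i * Complex.exp ((-(2 * Real.pi * ((i : ℕ) + 1) * t) : ℝ) * Complex.I)

lemma powerSpectrum_eq {m : ℕ} (x : Fin m → ℂ) (k : Fin m) :
    powerSpectrum x k = ‖signalDTFT x ((k : ℕ) / m)‖ ^ 2 := by
  rw [powerSpectrum, signalDFT, signalDTFT]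
  congr 2
  refine Finset.sum_congr rfl fun i _ => ?_
  congr 2
  push_cast
  ring

/-- Wiener–Khinchin: the squared modulus of the Fourier transform is the symbol with the
autocorrelations as coefficients. -/
lemma normSq_signalDTFT {m : ℕ} (x : Fin m → ℂ) (t : ℝ) :
    ((‖signalDTFT x t‖ ^ 2 : ℝ) : ℂ) =
      trigPoly (Finset.Ioo (-(m : ℤ)) m) (autocorr x) t := by
  rw [Complex.ofReal_pow, ← Complex.mul_conj', signalDTFT, map_sum, Finset.sum_mul_sum,
    ← Finset.sum_product', Finset.univ_product_univ, trigPoly,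
    ← Finset.sum_fiberwise_of_maps_to (t := Finset.Ioo (-(m : ℤ)) m)
      (g := fun p : Fin m × Fin m => (p.1 : ℤ) - (p.2 : ℤ))
      (fun p _ => by rw [Finset.mem_Ioo]; omega)]
  refine Finset.sum_congr rfl fun l _ => ?_
  rw [autocorr, Finset.sum_mul]
  refine Finset.sum_congr rfl fun p hp => ?_
  rw [← (Finset.mem_filter.1 hp).2, map_mul, ← Complex.exp_conj, mul_mul_mul_comm,
    ← Complex.exp_add]
  congr 2
  simp only [map_mul, Complex.conj_ofReal, Complex.conj_I]
  push_cast
  ring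

lemma powerSpectrum_eq_trigPoly {m : ℕ} (x : Fin m → ℂ) (k : Fin m) :
    (powerSpectrum x k : ℂ) =
      trigPoly (Finset.Ioo (-(m : ℤ)) m) (autocorr x) ((k : ℕ) / m) := by
  rw [powerSpectrum_eq, normSq_signalDTFT]

lemma powerSpectrum_eq_sum_autocorr {m : ℕ} (x : Fin m → ℂ) (k : Fin m) :
    (powerSpectrum x k : ℂ) = ∑ i ∈ Finset.Ioo (-(m : ℤ)) (m : ℤ), autocorr x i *
      Complex.exp (-(Complex.I * (2 * Real.pi * (k : ℕ) * i / m))) := by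
  rw [powerSpectrum_eq_trigPoly, trigPoly]
  refine Finset.sum_congr rfl fun i _ => ?_
  congr 2
  push_cast
  ring

lemma sum_powerSpectrum {m : ℕ} (x : Fin m → ℂ) :
    ∑ k, powerSpectrum x k = m * ∑ i, ‖x i‖ ^ 2 := by
  have h := sum_trigPoly_mul_exp (Finset.Ioo (-(m : ℤ)) m) (autocorr x) m 0 fun l hl => by
    rw [Finset.mem_Ioo] at hl
    rw [abs_lt]
    omega
  simp only [← powerSpectrum_eq_trigPoly, autocorr_zero] at h
  rcases Nat.eq_zero_or_pos m with rfl | hm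
  · simp
  · rw [if_pos (by rw [Finset.mem_Ioo]; omega)] at h
    simp at h
    exact_mod_cast h

/-- The covariance form depends on the signal only through `|signalDTFT x|²`, so pointwise
inequalities between such functions are inequalities between covariance matrices. -/
lemma toeplitzForm_autocorr_eq {m : ℕ} (x v : Fin m → ℂ) :
    (toeplitzForm (autocorr x) v).re = ∑ k : Fin (m + m),
      ‖signalDTFT x ((k : ℕ) / (m + m : ℕ))‖ ^ 2 * ‖fourierGrid m (m + m) v k‖ ^ 2 := by
  have h1 : toeplitzForm (autocorr x) v = toeplitzForm
      (fun l => if l ∈ Finset.Ioo (-(m : ℤ)) m then autocorr x l else 0) v := by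
    refine Finset.sum_congr rfl fun i _ => Finset.sum_congr rfl fun j _ => ?_
    beta_reduce
    rw [if_pos (by rw [Finset.mem_Ioo]; omega)]
  rw [h1, toeplitzForm_indicator_eq (N := m + m) _ _ (fun l hl => by
    have := Finset.mem_Ioo.1 hl
    have : |l| ≤ m := abs_le.2 ⟨by omega, by omega⟩
    push_cast
    omega) v, Complex.re_sum]
  refine Finset.sum_congr rfl fun k _ => ?_
  rw [← normSq_signalDTFT, Complex.re_mul_ofReal, Complex.ofReal_re]

/-! ### Perturbation of the signal -/

lemma signalDTFT_add {m : ℕ} (x y : Fin m → ℂ) (t : ℝ) :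
    signalDTFT (x + y) t = signalDTFT x t + signalDTFT y t := by
  simp only [signalDTFT, Pi.add_apply, add_mul, Finset.sum_add_distrib]

lemma normSq_add_le {δ : ℝ} (hδ : 0 < δ) (u w : ℂ) :
    ‖u + w‖ ^ 2 ≤ (1 + δ) * ‖u‖ ^ 2 + (1 + δ⁻¹) * ‖w‖ ^ 2 := by
  have h1 : ‖u + w‖ ^ 2 ≤ (‖u‖ + ‖w‖) ^ 2 := by
    gcongr
    exact norm_add_le u w
  have h2 : 0 ≤ δ⁻¹ * (δ * ‖u‖ - ‖w‖) ^ 2 := by positivity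
  have h3 : δ⁻¹ * (δ * ‖u‖ - ‖w‖) ^ 2 = δ * ‖u‖ ^ 2 - 2 * (‖u‖ * ‖w‖) + δ⁻¹ * ‖w‖ ^ 2 := by
    field_simp
    ring
  nlinarith

lemma normSq_le_add {δ : ℝ} (hδ : 0 < δ) (u w : ℂ) :
    ‖u‖ ^ 2 ≤ (1 + δ) * ‖u‖ ^ 2 + (1 + δ⁻¹) * ‖w‖ ^ 2 := by
  have : 0 ≤ δ * ‖u‖ ^ 2 + (1 + δ⁻¹) * ‖w‖ ^ 2 := by positivity
  linarith

/-- The covariance matrices of `y + z` and of `y` are both below `(1 + δ) C_y + (1 + δ⁻¹) C_z`, so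
the sorted eigenvalues are compared by traces. -/
lemma sum_abs_sort_eigenvalues_sub_le {m : ℕ} (y z : Fin m → ℂ) {δ : ℝ} (hδ : 0 < δ) :
    ∑ i, |covEigenvalues (y + z) (Tuple.sort (covEigenvalues (y + z)) i) -
        covEigenvalues y (Tuple.sort (covEigenvalues y) i)| ≤
      m * (2 * ((1 + δ) * ∑ i, ‖y i‖ ^ 2 + (1 + δ⁻¹) * ∑ i, ‖z i‖ ^ 2) -
        ∑ i, ‖(y + z) i‖ ^ 2 - ∑ i, ‖y i‖ ^ 2) := by
  set Q : Matrix (Fin m) (Fin m) ℂ :=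
    ((1 + δ : ℝ) : ℂ) • covMatrix y + ((1 + δ⁻¹ : ℝ) : ℂ) • covMatrix z with hQdef
  have hQ : Q.IsHermitian := by
    have hy := covMatrix_isHermitian y
    have hz := covMatrix_isHermitian z
    rw [Matrix.IsHermitian] at hy hz ⊢
    simp [hQdef, Matrix.conjTranspose_add, Matrix.conjTranspose_smul, hy, hz]
  have hform : ∀ v, (star v ⬝ᵥ Q.mulVec v).re = (1 + δ) * (toeplitzForm (autocorr y) v).re +
      (1 + δ⁻¹) * (toeplitzForm (autocorr z) v).re := fun v => by
    rw [hQdef, Matrix.add_mulVec, Matrix.smul_mulVec, Matrix.smul_mulVec, dotProduct_add,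
      dotProduct_smul, dotProduct_smul, star_dotProduct_covMatrix_mulVec,
      star_dotProduct_covMatrix_mulVec, Complex.add_re, smul_eq_mul, smul_eq_mul,
      Complex.re_ofReal_mul, Complex.re_ofReal_mul]
  have hdom : ∀ (x : Fin m → ℂ), (∀ t, ‖signalDTFT x t‖ ^ 2 ≤
      (1 + δ) * ‖signalDTFT y t‖ ^ 2 + (1 + δ⁻¹) * ‖signalDTFT z t‖ ^ 2) → ∀ v,
      (star v ⬝ᵥ (covMatrix x).mulVec v).re ≤ (star v ⬝ᵥ Q.mulVec v).re := fun x hx v => by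
    rw [hform, star_dotProduct_covMatrix_mulVec, toeplitzForm_autocorr_eq,
      toeplitzForm_autocorr_eq, toeplitzForm_autocorr_eq, Finset.mul_sum, Finset.mul_sum,
      ← Finset.sum_add_distrib]
    refine Finset.sum_le_sum fun k _ => ?_
    rw [← mul_assoc, ← mul_assoc, ← add_mul]
    gcongr
    exact hx _
  have htr : Q.trace = ((m * ((1 + δ) * ∑ i, ‖y i‖ ^ 2 + (1 + δ⁻¹) * ∑ i, ‖z i‖ ^ 2) : ℝ) : ℂ) := by
    rw [hQdef, Matrix.trace_add, Matrix.trace_smul, Matrix.trace_smul, trace_covMatrix,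
      trace_covMatrix]
    push_cast
    simp only [smul_eq_mul]
    ring
  have h := sum_abs_sort_sub_sort_le (covEigenvalues (y + z)) (covEigenvalues y) hQ.eigenvalues
    (card_le_eigenvalues_mono _ hQ (hdom (y + z) fun t => by
      rw [signalDTFT_add]; exact normSq_add_le hδ _ _))
    (card_le_eigenvalues_mono _ hQ (hdom y fun t => normSq_le_add hδ _ _))
  rw [hQ.sum_eigenvalues_eq_of_trace htr, sum_covEigenvalues, sum_covEigenvalues] at h
  linarith

/-- The analogue of `sum_abs_sort_eigenvalues_sub_le` for power spectra, with the same bound,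
since the trace of `C_x` is the sum of the power spectrum of `x`. -/
lemma sum_abs_sort_powerSpectrum_sub_le {m : ℕ} (y z : Fin m → ℂ) {δ : ℝ} (hδ : 0 < δ) :
    ∑ i, |powerSpectrum (y + z) (Tuple.sort (powerSpectrum (y + z)) i) -
        powerSpectrum y (Tuple.sort (powerSpectrum y) i)| ≤
      m * (2 * ((1 + δ) * ∑ i, ‖y i‖ ^ 2 + (1 + δ⁻¹) * ∑ i, ‖z i‖ ^ 2) -
        ∑ i, ‖(y + z) i‖ ^ 2 - ∑ i, ‖y i‖ ^ 2) := by
  have hcard : ∀ a b : Fin m → ℝ, (∀ i, a i ≤ b i) → ∀ t,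
      (Finset.univ.filter fun i => t ≤ a i).card ≤ (Finset.univ.filter fun i => t ≤ b i).card :=
    fun a b hab t => Finset.card_le_card fun i hi => by
      simp only [Finset.mem_filter, Finset.mem_univ, true_and] at hi ⊢
      exact hi.trans (hab i)
  have h := sum_abs_sort_sub_sort_le (powerSpectrum (y + z)) (powerSpectrum y)
    (fun k => (1 + δ) * powerSpectrum y k + (1 + δ⁻¹) * powerSpectrum z k)
    (hcard _ _ fun k => by
      simp only [powerSpectrum_eq, signalDTFT_add]
      exact normSq_add_le hδ _ _)
    (hcard _ _ fun k => by
      simp only [powerSpectrum_eq]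
      exact normSq_le_add hδ _ _)
  simp only [Finset.sum_add_distrib, ← Finset.mul_sum, sum_powerSpectrum] at h
  linarith

/-! ### Matching eigenvalues with the power spectrum -/

lemma toeplitzForm_neg {m : ℕ} (c : ℤ → ℂ) (v : Fin m → ℂ) :
    toeplitzForm (-c) v = -toeplitzForm c v := by
  simp [toeplitzForm]

lemma trigPoly_neg (S : Finset ℤ) (c : ℤ → ℂ) (t : ℝ) : trigPoly S (-c) t = -trigPoly S c t := by
  simp [trigPoly]

/-- The eigenvalues of the covariance matrix listed so that the `j`-th smallest eigenvalue stands
at the index of the `j`-th smallest value of the power spectrum. -/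
noncomputable def matchedEigenvalues {m : ℕ} (x : Fin m → ℂ) (k : Fin m) : ℝ :=
  covEigenvalues x (Tuple.sort (covEigenvalues x) ((Tuple.sort (powerSpectrum x)).symm k))

lemma isEigenvalueList_matchedEigenvalues {m : ℕ} (x : Fin m → ℂ) :
    IsEigenvalueList (covMatrix x) (matchedEigenvalues x) := by
  rw [IsEigenvalueList, (covMatrix_isHermitian x).charpoly_eq]
  exact (Equiv.prod_comp ((Tuple.sort (powerSpectrum x)).symm.trans
    (Tuple.sort (covEigenvalues x)))
    fun i => Polynomial.X - Polynomial.C (covEigenvalues x i : ℂ)).symm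

lemma abs_matchedEigenvalues_sub {m : ℕ} (x : Fin m → ℂ) (k : Fin m) :
    |matchedEigenvalues x k - powerSpectrum x k| =
      (fun i => |covEigenvalues x (Tuple.sort (covEigenvalues x) i) -
        powerSpectrum x (Tuple.sort (powerSpectrum x) i)|)
          ((Tuple.sort (powerSpectrum x)).symm k) := by
  simp [matchedEigenvalues]

lemma sum_abs_matchedEigenvalues_sub {m : ℕ} (x : Fin m → ℂ) :
    ∑ k, |matchedEigenvalues x k - powerSpectrum x k| =
      ∑ i, |covEigenvalues x (Tuple.sort (covEigenvalues x) i) -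
        powerSpectrum x (Tuple.sort (powerSpectrum x) i)| := by
  simp only [abs_matchedEigenvalues_sub]
  exact Equiv.sum_comp (Tuple.sort (powerSpectrum x)).symm fun i =>
    |covEigenvalues x (Tuple.sort (covEigenvalues x) i) -
      powerSpectrum x (Tuple.sort (powerSpectrum x) i)|

lemma abs_sort_covEigenvalues_sub_le {m : ℕ} (x : Fin m → ℂ) (M ε : ℝ) (K : ℕ)
    (hM : ∑ l ∈ Finset.Ioo (-(m : ℤ)) m, ‖autocorr x l‖ ≤ M)
    (htail : ∑ l ∈ Finset.Ioo (-(m : ℤ)) m with (K : ℤ) ≤ |l|, ‖autocorr x l‖ ≤ ε)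
    (hm : 2 * Real.pi * K * M * (K + 1) ≤ ε * m) (i : Fin m) :
    |covEigenvalues x (Tuple.sort (covEigenvalues x) i) -
      powerSpectrum x (Tuple.sort (powerSpectrum x) i)| ≤ 4 * ε := by
  have hU := sum_normSq_toLin'_of_star_mul_self
    ((covMatrix_isHermitian x).eigenvectorUnitary : Matrix (Fin m) (Fin m) ℂ)
    (Unitary.coe_star_mul_self _)
  have hform := fun v => sum_eigenvalues_mul_normSq (covMatrix_isHermitian x) v
  simp only [star_dotProduct_covMatrix_mulVec] at hform
  have hP : ∀ p : Fin m, (trigPoly (Finset.Ioo (-(m : ℤ)) m) (autocorr x) ((p : ℕ) / m)).re =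
      powerSpectrum x p := fun p => by
    rw [← powerSpectrum_eq_trigPoly, Complex.ofReal_re]
  have hup := card_filter_le_card_samples (autocorr x) (covEigenvalues x) _ hU hform M ε K hM
    htail hm
  -- The lower bound is the upper bound for the Toeplitz form with the opposite symbol.
  have hlow := card_filter_le_card_samples (-autocorr x) (-covEigenvalues x) _ hU
    (fun v => by
      rw [toeplitzForm_neg, Complex.neg_re, ← hform v]
      simp [covEigenvalues]) M ε K (by simpa using hM) (by simpa using htail) hm
  simp only [trigPoly_neg, Complex.neg_re, hP] at hup hlow
  rw [abs_sub_le_iff]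
  constructor
  · linarith [sort_le_sort_add (covEigenvalues x) (powerSpectrum x) (4 * ε) hup i]
  · have := sort_le_sort_add_of_card_le (covEigenvalues x) (powerSpectrum x) (4 * ε) (fun t => by
      have h := hlow (-t)
      have h1 : ∀ p : Fin m, -t - 4 * ε ≤ -powerSpectrum x p ↔ powerSpectrum x p ≤ t + 4 * ε :=
        fun p => ⟨fun h => by linarith, fun h => by linarith⟩
      simpa only [Pi.neg_apply, neg_le_neg_iff, h1] using h) i
    linarith

lemma UniformlyAbsSummableAutocorr.exists_abs_sort_sub_le {x : (m : ℕ) → Fin m → ℂ}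
    (hx : UniformlyAbsSummableAutocorr x) {ε : ℝ} (hε : 0 < ε) :
    ∃ m₀ : ℕ, ∀ m, m₀ ≤ m → ∀ i : Fin m,
      |covEigenvalues (x m) (Tuple.sort (covEigenvalues (x m)) i) -
        powerSpectrum (x m) (Tuple.sort (powerSpectrum (x m)) i)| ≤ ε := by
  obtain ⟨⟨M, hM⟩, htail⟩ := hx
  obtain ⟨K, hK⟩ := htail (ε / 4) (by positivity)
  obtain ⟨m₀, hm₀⟩ := exists_nat_ge (2 * Real.pi * K * M * (K + 1) / (ε / 4))
  refine ⟨m₀, fun m hm i => ?_⟩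
  have h1 : 2 * Real.pi * K * M * (K + 1) ≤ ε / 4 * m := by
    rw [← div_le_iff₀' (by positivity)]
    exact hm₀.trans (by exact_mod_cast hm)
  have := abs_sort_covEigenvalues_sub_le (x m) M (ε / 4) K (hM m) (hK m) h1 i
  linarith

/-! ### Truncations of a square-summable signal -/

lemma sum_norm_autocorr_le {m : ℕ} (x : Fin m → ℂ) (S : Finset ℤ) :
    ∑ k ∈ S, ‖autocorr x k‖ ≤ (∑ i, ‖x i‖) ^ 2 := by
  calc ∑ k ∈ S, ‖autocorr x k‖
      ≤ ∑ k ∈ S, ∑ p : Fin m × Fin m with (p.1 : ℤ) - (p.2 : ℤ) = k, ‖x p.1‖ * ‖x p.2‖ := by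
        refine Finset.sum_le_sum fun k _ => (norm_sum_le _ _).trans_eq ?_
        simp
    _ ≤ ∑ p : Fin m × Fin m, ‖x p.1‖ * ‖x p.2‖ :=
        Finset.sum_fiberwise_le_sum_of_sum_fiber_nonneg fun _ _ =>
          Finset.sum_nonneg fun _ _ => by positivity
    _ = (∑ i, ‖x i‖) ^ 2 := by rw [sq, Finset.sum_mul_sum, Fintype.sum_prod_type]

/-- The infinite signal with all samples from index `K` on replaced by `0`. -/
noncomputable def truncate (s : ℕ → ℂ) (K : ℕ) : ℕ → ℂ := fun i => if i < K then s i else 0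

lemma autocorr_initialSegment_truncate_eq_zero (s : ℕ → ℂ) (K m : ℕ) {k : ℤ} (hk : (K : ℤ) ≤ |k|) :
    autocorr (initialSegment (truncate s K) m) k = 0 := by
  refine Finset.sum_eq_zero fun p hp => ?_
  have h := (Finset.mem_filter.1 hp).2
  simp only [initialSegment, truncate]
  by_cases h1 : (p.1 : ℕ) < K
  · have h2 : ¬ (p.2 : ℕ) < K := fun h2 => by
      have : |k| < K := abs_lt.2 ⟨by omega, by omega⟩
      omega
    simp [h2]
  · simp [h1]

lemma uniformlyAbsSummableAutocorr_truncate (s : ℕ → ℂ) (K : ℕ) :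
    UniformlyAbsSummableAutocorr (initialSegment (truncate s K)) := by
  refine ⟨⟨(∑ i ∈ Finset.range K, ‖s i‖) ^ 2, fun m => (sum_norm_autocorr_le _ _).trans ?_⟩,
    fun ε hε => ⟨K, fun m => ?_⟩⟩
  · gcongr
    simp only [initialSegment]
    rw [Fin.sum_univ_eq_sum_range (fun i => ‖truncate s K i‖)]
    simp only [truncate, apply_ite norm, norm_zero]
    rw [← Finset.sum_filter]
    exact Finset.sum_le_sum_of_subset_of_nonneg
      (fun i hi => Finset.mem_range.2 (Finset.mem_filter.1 hi).2) fun _ _ _ => norm_nonneg _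
  · rw [Finset.sum_eq_zero fun l hl => by
      rw [autocorr_initialSegment_truncate_eq_zero s K m (Finset.mem_filter.1 hl).2, norm_zero]]
    exact hε.le

lemma sum_normSq_initialSegment (s : ℕ → ℂ) (m : ℕ) :
    ∑ i, ‖initialSegment s m i‖ ^ 2 = ∑ i ∈ Finset.range m, ‖s i‖ ^ 2 :=
  Fin.sum_univ_eq_sum_range (fun i => ‖s i‖ ^ 2) m

lemma sum_range_normSq_truncate (s : ℕ → ℂ) {K m : ℕ} (h : K ≤ m) :
    ∑ i ∈ Finset.range m, ‖truncate s K i‖ ^ 2 = ∑ i ∈ Finset.range K, ‖s i‖ ^ 2 := by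
  rw [← Finset.sum_subset (Finset.range_subset_range.2 h) fun i _ hi => by
    simp [truncate, mt Finset.mem_range.2 hi]]
  exact Finset.sum_congr rfl fun i hi => by rw [truncate, if_pos (Finset.mem_range.1 hi)]

lemma sum_range_normSq_sub_truncate (s : ℕ → ℂ) {K m : ℕ} (h : K ≤ m) :
    ∑ i ∈ Finset.range m, ‖(s - truncate s K) i‖ ^ 2 =
      ∑ i ∈ Finset.range m, ‖s i‖ ^ 2 - ∑ i ∈ Finset.range K, ‖s i‖ ^ 2 := by
  rw [← sum_range_normSq_truncate s h, ← Finset.sum_sub_distrib]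
  refine Finset.sum_congr rfl fun i _ => ?_
  by_cases hi : i < K <;> simp [truncate, hi]

/-- Replacing `y + z` by `y` changes the total distance between sorted eigenvalues and sorted
power spectrum by at most twice the trace bound: once for each of the two lists. -/
lemma sum_abs_matchedEigenvalues_sub_le {m : ℕ} (y z : Fin m → ℂ) {δ : ℝ} (hδ : 0 < δ) :
    ∑ k, |matchedEigenvalues (y + z) k - powerSpectrum (y + z) k| ≤
      ∑ k, |matchedEigenvalues y k - powerSpectrum y k| +
        2 * (m * (2 * ((1 + δ) * ∑ i, ‖y i‖ ^ 2 + (1 + δ⁻¹) * ∑ i, ‖z i‖ ^ 2) -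
          ∑ i, ‖(y + z) i‖ ^ 2 - ∑ i, ‖y i‖ ^ 2)) := by
  have h1 := sum_abs_sort_eigenvalues_sub_le y z hδ
  have h2 := sum_abs_sort_powerSpectrum_sub_le y z hδ
  rw [sum_abs_matchedEigenvalues_sub, sum_abs_matchedEigenvalues_sub]
  refine le_trans (Finset.sum_le_sum fun i _ => ?_) (by
    rw [two_mul (_ * _)]
    exact (Finset.sum_add_distrib.trans_le (add_le_add
      (Finset.sum_add_distrib.trans_le (add_le_add_right h1 _)) h2)).trans_eq (add_assoc _ _ _))
  generalize covEigenvalues (y + z) _ = a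
  generalize covEigenvalues y _ = b
  generalize powerSpectrum (y + z) _ = c
  generalize powerSpectrum y _ = d
  have h3 : a - c = (b - d) + (a - b) - (c - d) := by ring
  rw [h3]
  exact (abs_sub _ _).trans (add_le_add_left (abs_add_le _ _) _)

/-- For a square-summable signal, truncate at `K`: the truncated signal has finitely many nonzero
autocorrelations, so the uniform result applies to it, and the error of the truncation is `O(m (δ
E + (1 + δ⁻¹) (E - E_K)))`, where `E_K` is the energy of the first `K` samples. -/
lemma tendsto_mean_abs_matchedEigenvalues_sub (s : ℕ → ℂ) (E : ℝ)
    (hE : Tendsto (fun m => ∑ i ∈ Finset.range m, ‖s i‖ ^ 2) atTop (𝓝 E)) :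
    Tendsto (fun m : ℕ => (1 / (m : ℝ)) * ∑ k : Fin m,
      |matchedEigenvalues (initialSegment s m) k - powerSpectrum (initialSegment s m) k|)
      atTop (𝓝 0) := by
  have hmono : Monotone fun m => ∑ i ∈ Finset.range m, ‖s i‖ ^ 2 := fun a b hab =>
    Finset.sum_le_sum_of_subset_of_nonneg (Finset.range_subset_range.2 hab)
      fun _ _ _ => by positivity
  have hle : ∀ m, ∑ i ∈ Finset.range m, ‖s i‖ ^ 2 ≤ E := hmono.ge_of_tendsto hE
  have hE0 : 0 ≤ E := by simpa using hle 0
  rw [Metric.tendsto_atTop]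
  intro ε hε
  set δ : ℝ := ε / (16 * (E + 1)) with hδ_def
  have hδ : 0 < δ := by positivity
  have hδE : δ * E ≤ ε / 16 := by
    rw [hδ_def, div_mul_eq_mul_div, div_le_div_iff₀ (by positivity) (by positivity)]
    nlinarith
  -- `δ` makes `δ E` small; then `K` makes the energy beyond `K` small against `1 + 2 δ⁻¹`.
  obtain ⟨K, hK⟩ := ((tendsto_order.1 hE).1 (E - ε / (8 * (1 + 2 * δ⁻¹)))
    (sub_lt_self _ (by positivity))).exists
  obtain ⟨m₀, hm₀⟩ := (uniformlyAbsSummableAutocorr_truncate s K).exists_abs_sort_sub_le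
    (show 0 < ε / 4 by positivity)
  refine ⟨max (K + 1) m₀, fun m hm => ?_⟩
  have hKm : K ≤ m := by have := le_max_left (K + 1) m₀; omega
  have hm0 : (0 : ℝ) < m := by
    have := le_max_left (K + 1) m₀
    exact_mod_cast (by omega : 0 < m)
  have hdecomp : initialSegment s m =
      initialSegment (truncate s K) m + initialSegment (s - truncate s K) m := by
    funext i
    simp [initialSegment]
  have h1 := sum_abs_matchedEigenvalues_sub_le (initialSegment (truncate s K) m)
    (initialSegment (s - truncate s K) m) hδ
  rw [← hdecomp] at h1
  simp only [sum_normSq_initialSegment] at h1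
  rw [sum_range_normSq_truncate s hKm, sum_range_normSq_sub_truncate s hKm] at h1
  have h2 : ∑ k, |matchedEigenvalues (initialSegment (truncate s K) m) k -
      powerSpectrum (initialSegment (truncate s K) m) k| ≤ m * (ε / 4) := by
    rw [sum_abs_matchedEigenvalues_sub]
    refine (Finset.sum_le_card_nsmul _ _ (ε / 4) fun i _ =>
      hm₀ m ((le_max_right _ _).trans hm) i).trans_eq ?_
    simp
  have hEm := hle m
  have hEK := hle K
  generalize ∑ i ∈ Finset.range m, ‖s i‖ ^ 2 = Em at *
  generalize ∑ i ∈ Finset.range K, ‖s i‖ ^ 2 = EK at *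
  -- With `‖y + z‖² = ‖y‖² + ‖z‖²` the trace bound is `m * (2 δ E_K + (1 + 2 δ⁻¹) (E_m - E_K))`.
  have h3 : (1 + 2 * δ⁻¹) * (Em - EK) ≤ ε / 8 := by
    have : Em - EK ≤ ε / (8 * (1 + 2 * δ⁻¹)) := by linarith
    calc (1 + 2 * δ⁻¹) * (Em - EK) ≤ (1 + 2 * δ⁻¹) * (ε / (8 * (1 + 2 * δ⁻¹))) := by gcongr
      _ = ε / 8 := by field_simp
  have h4 : δ * EK ≤ ε / 16 := (mul_le_mul_of_nonneg_left hEK hδ.le).trans hδE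
  have h5 : 2 * (2 * ((1 + δ) * EK + (1 + δ⁻¹) * (Em - EK)) - Em - EK) ≤ ε / 2 := by linarith
  have h6 : ∑ k : Fin m, |matchedEigenvalues (initialSegment s m) k -
      powerSpectrum (initialSegment s m) k| ≤ m * (ε / 4 + ε / 2) := by
    have := mul_le_mul_of_nonneg_left h5 hm0.le
    linarith
  rw [Real.dist_eq, sub_zero, abs_of_nonneg (by positivity), one_div, inv_mul_lt_iff₀ hm0]
  refine h6.trans_lt ?_
  gcongr
  linarith

theorem mainTheorem10 :
    (∀ (m : ℕ) (x : Fin m → ℂ) (k : Fin m),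
      (powerSpectrum x k : ℂ) =
        ∑ i ∈ Finset.Ioo (-(m : ℤ)) (m : ℤ), autocorr x i *
          Complex.exp (-(Complex.I * (2 * Real.pi * (k : ℕ) * i / m)))) ∧
    (∀ x : (m : ℕ) → Fin m → ℂ, UniformlyAbsSummableAutocorr x →
      ∃ ev : (m : ℕ) → Fin m → ℝ,
        (∀ m : ℕ, IsEigenvalueList (covMatrix (x m)) (ev m)) ∧
        ∀ ε : ℝ, 0 < ε → ∃ M : ℕ, ∀ m : ℕ, M ≤ m → ∀ k : Fin m,
          |ev m k - powerSpectrum (x m) k| < ε) ∧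
    (∀ (s : ℕ → ℂ) (c : ℤ → ℂ),
      (∀ k : ℤ, Tendsto (fun m : ℕ => autocorr (initialSegment s m) k) atTop (𝓝 (c k))) →
      Summable (fun k : ℤ => ‖c k‖) →
      ∃ ev : (m : ℕ) → Fin m → ℝ,
        (∀ m : ℕ, IsEigenvalueList (covMatrix (initialSegment s m)) (ev m)) ∧
        Tendsto (fun m : ℕ => (1 / (m : ℝ)) *
          ∑ k : Fin m, |ev m k - powerSpectrum (initialSegment s m) k|) atTop (𝓝 0)) := by
  refine ⟨fun m x k => powerSpectrum_eq_sum_autocorr x k, fun x hx => ?_, fun s c hc _ => ?_⟩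
  · refine ⟨fun m => matchedEigenvalues (x m),
      fun m => isEigenvalueList_matchedEigenvalues (x m), fun ε hε => ?_⟩
    obtain ⟨M, hM⟩ := hx.exists_abs_sort_sub_le (half_pos hε)
    refine ⟨M, fun m hm k => ?_⟩
    rw [abs_matchedEigenvalues_sub]
    exact (hM m hm _).trans_lt (half_lt_self hε)
  · refine ⟨fun m => matchedEigenvalues (initialSegment s m),
      fun m => isEigenvalueList_matchedEigenvalues _,
      tendsto_mean_abs_matchedEigenvalues_sub s (c 0).re ?_⟩
    have h := (Complex.continuous_re.tendsto _).comp (hc 0)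
    refine h.congr fun m => ?_
    rw [Function.comp_apply, autocorr_zero, Complex.ofReal_re, sum_normSq_initialSegment]
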